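/- Let $d\ge 3$ and let $X=(X_n)_{n\ge 0}$ be a random walk on $\mathbb Z^d$ started at the origin (that is, $X_0=0$ and the increments $X_{n+1}-X_n$ are independent and identically distributed). Assume that $X$ is symmetric ($X_1$ and $-X_1$ have the same law), transient (almost surely it visits the origin only finitely often), not supported on any subgroup of $\mathbb Z^d$ strictly smaller than $\mathbb Z^d$, and has finite second moments ($\mathbf E|X_1|^2<\infty$). For $B\subseteq\mathbb Z^d$ let $$\mu^X_n(B)=\sum_{j=0}^n \mathbf 1_B(X_j)$$ be the occupation measure of $X$ up to time $n$, and let $G(x)=\sum_{k=0}^\infty \mathbf P(X_k=x)$ be the Green's function. Let $A\subseteq\mathbb Z^d$ be a non-empty finite set, and let $\Lambda_A$ be the largest eigenvalue of the $|A|\times|A|$ matrix $G_A(x,y)=G(x-y)$, $x,y\in A$. Then $$\lim_{n\to\infty}\ \sup_{x\in\mathbb Z^d}\frac{\mu^X_n(x+A)}{\log n}=-\frac{1}{\log(1-1/\Lambda_A)}\qquad\text{almost surely}$$ and $$\lim_{n\to\infty}\ \sup_{0\le m\le n}\frac{\mu^X_n(X_m+A)}{\log n}=-\frac{1}{\log(1-1/\Lambda_A)}\qquad\text{almost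 surely.}$$ -/

import Mathlib

open MeasureTheory ProbabilityTheory Filter Topology
open scoped Pointwise

namespace LatticeWalk

noncomputable section

variable {d : ℕ} {Ω : Type*} [MeasurableSpace Ω]

/-- `X` is a random walk on `ℤ^d` started at the origin: its increments
`X (n + 1) - X n` are independent and all distributed as the first one. -/
structure IsRandomWalk (P : Measure Ω) (X : ℕ → Ω → (Fin d → ℤ)) : Prop where
  measurable : ∀ n, Measurable (X n)
  start : ∀ᵐ ω ∂P, X 0 ω = 0
  indep : iIndepFun (fun n ω => X (n + 1) ω - X n ω) P
  identDistrib : ∀ n,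
    IdentDistrib (fun ω => X (n + 1) ω - X n ω) (fun ω => X 1 ω - X 0 ω) P P

/-- The one-step law is invariant under `x ↦ -x`. -/
def IsSymmetricWalk (P : Measure Ω) (X : ℕ → Ω → (Fin d → ℤ)) : Prop :=
  IdentDistrib (X 1) (fun ω => -X 1 ω) P P

/-- Almost surely the origin is visited only finitely often. -/
def IsTransient (P : Measure Ω) (X : ℕ → Ω → (Fin d → ℤ)) : Prop :=
  ∀ᵐ ω ∂P, {n : ℕ | X n ω = 0}.Finite

/-- The walk is not supported on any subgroup strictly smaller than `ℤ^d`. -/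
def NotSupportedOnProperSubgroup (P : Measure Ω) (X : ℕ → Ω → (Fin d → ℤ)) : Prop :=
  ∀ H : AddSubgroup (Fin d → ℤ), (∀ᵐ ω ∂P, ∀ n, X n ω ∈ H) → H = ⊤

/-- Each coordinate of `X 1` is square integrable. -/
def HasFiniteSecondMoments (P : Measure Ω) (X : ℕ → Ω → (Fin d → ℤ)) : Prop :=
  ∀ i : Fin d, Integrable (fun ω => ((X 1 ω i : ℤ) : ℝ) ^ 2) P

/-- The occupation measure: the number of times `0 ≤ j ≤ n` with `X j ∈ A`. -/
def occupation (X : ℕ → Ω → (Fin d → ℤ)) (n : ℕ) (A : Set (Fin d → ℤ)) (ω : Ω) : ℝ :=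
  ∑ j ∈ Finset.range (n + 1), A.indicator (fun _ => (1 : ℝ)) (X j ω)

/-- The Green's function `G(x) = ∑ₖ P(Xₖ = x)`. -/
def green (P : Measure Ω) (X : ℕ → Ω → (Fin d → ℤ)) (x : Fin d → ℤ) : ℝ :=
  ∑' k : ℕ, P.real {ω | X k ω = x}

/-- The matrix `G(x - y)`, `x, y ∈ A`. -/
def greenMatrix (P : Measure Ω) (X : ℕ → Ω → (Fin d → ℤ)) (A : Finset (Fin d → ℤ)) :
    Matrix A A ℝ :=
  Matrix.of fun x y => green P X (x.1 - y.1)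

/-- The largest eigenvalue of a real square matrix. The set of real eigenvalues is always finite,
and for a symmetric matrix of positive size it is non-empty, so the supremum is a maximum. -/
def largestEigenvalue {ι : Type*} [Fintype ι] [DecidableEq ι] (M : Matrix ι ι ℝ) : ℝ :=
  sSup {l : ℝ | Module.End.HasEigenvalue (Matrix.toLin' M) l}

end

end LatticeWalk

/-! Let `Λ` be the largest eigenvalue of the Green matrix on `A` and `v` its positive eigenvector,
which exists by Perron's argument. The potential `u` of the charge `v` on `A` equals `Λ v` on `A`,
it is harmonic off `A`, and its mean after one step from `x ∈ A` is `u x - v x = (1 - 1/Λ) u x`.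
Hence each visit to `A` costs a factor `1 - 1/Λ`, and the probability of `k` visits is of order
`(1 - 1/Λ)^k`. Truncating the potential in time keeps the upper bound, and gives the lower bound
within a time linear in `k`, up to an arbitrarily small loss in the rate.

The upper bound on the limit follows from Borel-Cantelli and a union bound over the time of the
first visit to a translate of `A`. For the lower bound, the path up to time `n` splits into of order
`n / log n` independent blocks. For `k = c log n`, some block makes `k` visits to the translate of
`A` by its starting point with high probability as long as `(1 - 1/Λ)^(-k)` is a power of `n` with
exponent less than `1`. -/

namespace LatticeWalk

noncomputable section

section Perron

open Matrix

variable {ι : Type*} [Fintype ι] [DecidableEq ι] {M : Matrix ι ι ℝ}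

lemma largestEigenvalue_eq_sSup_spectrum (M : Matrix ι ι ℝ) :
    largestEigenvalue M = sSup (spectrum ℝ M) := by
  simp only [largestEigenvalue, Module.End.hasEigenvalue_iff_mem_spectrum, spectrum_toLin',
    Set.ofPred_mem_eq]

lemma le_largestEigenvalue {l : ℝ} (hl : l ∈ spectrum ℝ M) : l ≤ largestEigenvalue M := by
  rw [largestEigenvalue_eq_sSup_spectrum]
  exact le_csSup M.finite_spectrum.bddAbove hl

lemma largestEigenvalue_mem_spectrum [Nonempty ι] (hM : M.IsHermitian) :
    largestEigenvalue M ∈ spectrum ℝ M := by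
  rw [largestEigenvalue_eq_sSup_spectrum]
  exact Set.Nonempty.csSup_mem ⟨_, hM.eigenvalues_mem_spectrum_real (Classical.arbitrary ι)⟩
    M.finite_spectrum

lemma posSemidef_largestEigenvalue_smul_one_sub (hM : M.IsHermitian) :
    (largestEigenvalue M • 1 - M).PosSemidef := by
  have hN : (largestEigenvalue M • 1 - M).IsHermitian :=
    (isHermitian_one.smul (star_trivial _)).sub hM
  refine posSemidef_iff_isHermitian_and_spectrum_nonneg.2 ⟨hN, ?_⟩
  rw [← Algebra.algebraMap_eq_smul_one, ← spectrum.singleton_sub_eq, Set.singleton_sub]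
  rintro _ ⟨l, hl, rfl⟩
  exact sub_nonneg.2 (le_largestEigenvalue hl)

lemma mulVec_eq_largestEigenvalue_smul_of_le (hM : M.IsHermitian) {u : ι → ℝ}
    (hu : largestEigenvalue M * (u ⬝ᵥ u) ≤ u ⬝ᵥ M *ᵥ u) : M *ᵥ u = largestEigenvalue M • u := by
  have hpsd := posSemidef_largestEigenvalue_smul_one_sub hM
  have hquad : u ⬝ᵥ (largestEigenvalue M • 1 - M) *ᵥ u =
      largestEigenvalue M * (u ⬝ᵥ u) - u ⬝ᵥ M *ᵥ u := by
    simp only [sub_mulVec, smul_mulVec, one_mulVec, dotProduct_sub, dotProduct_smul, smul_eq_mul]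
  have hzero : u ⬝ᵥ (largestEigenvalue M • 1 - M) *ᵥ u = 0 :=
    le_antisymm (hquad.trans_le (sub_nonpos.2 hu)) (by simpa using hpsd.dotProduct_mulVec_nonneg u)
  have hker := (hpsd.dotProduct_mulVec_zero_iff u).1 (by rwa [star_trivial])
  rw [sub_mulVec, smul_mulVec, one_mulVec, sub_eq_zero] at hker
  exact hker.symm

omit [DecidableEq ι] in
lemma dotProduct_mulVec_le_abs (hM : ∀ i j, 0 ≤ M i j) (w : ι → ℝ) :
    w ⬝ᵥ M *ᵥ w ≤ |w| ⬝ᵥ M *ᵥ |w| := by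
  simp only [dotProduct, mulVec, Finset.mul_sum]
  refine Finset.sum_le_sum fun i _ => Finset.sum_le_sum fun j _ => (le_abs_self _).trans_eq ?_
  rw [abs_mul, abs_mul, abs_of_nonneg (hM i j), Pi.abs_apply, Pi.abs_apply]

omit [DecidableEq ι] in
lemma pos_of_mulVec_eq_smul (hM : ∀ i j, 0 < M i j) {u : ι → ℝ} (hu : 0 ≤ u) (hu0 : u ≠ 0) {l : ℝ}
    (hMu : M *ᵥ u = l • u) (i : ι) : 0 < u i := by
  obtain ⟨j, hj⟩ := Function.ne_iff.1 hu0
  have hpos : 0 < (M *ᵥ u) i :=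
    Finset.sum_pos' (fun k _ => mul_nonneg (hM i k).le (hu k))
      ⟨j, Finset.mem_univ j, mul_pos (hM i j) ((hu j).lt_of_ne' hj)⟩
  rw [hMu, Pi.smul_apply, smul_eq_mul] at hpos
  exact (hu i).lt_of_ne' (right_ne_zero_of_mul hpos.ne')

/- Perron: replacing a top eigenvector by its absolute value does not decrease the quadratic form,
so the absolute value is a top eigenvector as well. -/
theorem exists_pos_eigenvector [Nonempty ι] (hM : M.IsHermitian) (hpos : ∀ i j, 0 < M i j) :
    ∃ v : ι → ℝ, (∀ i, 0 < v i) ∧ M *ᵥ v = largestEigenvalue M • v := by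
  obtain ⟨w, hw⟩ := (Module.End.hasEigenvalue_iff_mem_spectrum.2
    ((spectrum_toLin' M).symm ▸ largestEigenvalue_mem_spectrum hM)).exists_hasEigenvector
  have hMw : M *ᵥ w = largestEigenvalue M • w := by simpa using hw.apply_eq_smul
  have hsq : |w| ⬝ᵥ |w| = w ⬝ᵥ w := by simp [dotProduct]
  have hquad : largestEigenvalue M * (|w| ⬝ᵥ |w|) ≤ |w| ⬝ᵥ M *ᵥ |w| :=
    calc largestEigenvalue M * (|w| ⬝ᵥ |w|) = w ⬝ᵥ M *ᵥ w := by
          rw [hMw, dotProduct_smul, smul_eq_mul, hsq]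
      _ ≤ |w| ⬝ᵥ M *ᵥ |w| := dotProduct_mulVec_le_abs (fun i j => (hpos i j).le) w
  have habs := mulVec_eq_largestEigenvalue_smul_of_le hM hquad
  exact ⟨|w|, pos_of_mulVec_eq_smul hpos (abs_nonneg w) (by simpa using hw.2) habs, habs⟩

end Perron

section Path

variable {E : Type*}

/-- The sequence of increments from time `m` on. -/
def shift (m : ℕ) (e : ℕ → E) : ℕ → E := fun i => e (m + i)

lemma shift_zero (e : ℕ → E) : shift 0 e = e := by
  funext i; simp only [shift, zero_add]

lemma shift_shift (m n : ℕ) (e : ℕ → E) : shift m (shift n e) = shift (n + m) e := by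
  funext i; simp only [shift, add_assoc]

variable [AddCommGroup E]

/-- The increments before time `m`, followed by zeros. An event `S` depends only on the first
`m` increments if and only if `past m ⁻¹' S = S`. -/
def past (m : ℕ) (e : ℕ → E) : ℕ → E := fun i => if i < m then e i else 0

/-- The position at time `j` of the walk with increments `e` started at `0`. -/
def walk (e : ℕ → E) (j : ℕ) : E := ∑ i ∈ Finset.range j, e i

/-- The number of visits to `A` strictly before time `n` of the walk with increments `e` started
at `x`. -/
def visits (A : Set E) (x : E) (e : ℕ → E) (n : ℕ) : ℕ :=
  ∑ j ∈ Finset.range n, A.indicator 1 (x + walk e j)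

@[simp] lemma walk_zero (e : ℕ → E) : walk e 0 = 0 := Finset.sum_range_zero e

lemma walk_succ (e : ℕ → E) (j : ℕ) : walk e (j + 1) = e 0 + walk (shift 1 e) j := by
  simp only [walk, shift, Finset.sum_range_succ', add_comm]

lemma walk_add (e : ℕ → E) (m j : ℕ) : walk e (m + j) = walk e m + walk (shift m e) j :=
  Finset.sum_range_add e m j

lemma walk_past {m j : ℕ} (h : j ≤ m) (e : ℕ → E) : walk (past m e) j = walk e j :=
  Finset.sum_congr rfl fun _ hi => if_pos ((Finset.mem_range.1 hi).trans_le h)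

lemma walk_sub_apply (X : ℕ → E) (n : ℕ) : walk (fun i => X (i + 1) - X i) n = X n - X 0 :=
  Finset.sum_range_sub X n

variable (A : Set E) (x : E) (e : ℕ → E)

@[simp] lemma visits_zero : visits A x e 0 = 0 := Finset.sum_range_zero _

lemma visits_succ (n : ℕ) :
    visits A x e (n + 1) = A.indicator 1 x + visits A (x + e 0) (shift 1 e) n := by
  simp only [visits, Finset.sum_range_succ', walk_succ, walk_zero, add_zero, add_assoc, add_comm]

lemma visits_mono : Monotone (visits A x e) := fun _ _ h =>
  Finset.sum_le_sum_of_subset (Finset.range_mono h)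

lemma visits_past (n : ℕ) : visits A x (past n e) n = visits A x e n :=
  Finset.sum_congr rfl fun _ hj => by rw [walk_past (Finset.mem_range.1 hj).le]

lemma visits_shift_le (m n : ℕ) : visits A 0 (shift m e) n ≤ visits A (-walk e m) e (m + n) := by
  rw [visits, visits, Finset.sum_range_add _ m]
  refine le_add_left (Finset.sum_le_sum fun j _ => ?_)
  rw [walk_add, neg_add_cancel_left, zero_add]

/- Restart the walk at its first visit to `A`. -/
lemma visits_eq_zero_or_le (n : ℕ) :
    visits A x e n = 0 ∨ ∃ m < n, ∃ a ∈ A, visits A x e n ≤ visits A a (shift m e) n := by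
  induction n generalizing x e with
  | zero => exact Or.inl (visits_zero A x e)
  | succ n ih =>
    by_cases hx : x ∈ A
    · exact Or.inr ⟨0, n.succ_pos, x, hx, by rw [shift_zero]⟩
    rw [visits_succ, Set.indicator_of_notMem hx, zero_add]
    refine (ih (x + e 0) (shift 1 e)).imp_right ?_
    rintro ⟨m, hm, a, ha, hle⟩
    rw [shift_shift] at hle
    exact ⟨1 + m, by omega, a, ha, hle.trans (visits_mono A a _ n.le_succ)⟩

end Path

section SequenceLaw

variable {E : Type*} [MeasurableSpace E]

@[fun_prop]
lemma measurable_shift (m : ℕ) : Measurable (shift m : (ℕ → E) → ℕ → E) :=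
  measurable_pi_lambda _ fun i => measurable_pi_apply (m + i)

/-- The law of a sequence of independent increments with common law `μ`. -/
abbrev seqLaw (μ : Measure E) : Measure (ℕ → E) := Measure.infinitePi fun _ : ℕ => μ

variable (μ : Measure E) [IsProbabilityMeasure μ]

lemma map_shift (m : ℕ) : (seqLaw μ).map (shift m) = seqLaw μ :=
  Measure.map_infinitePi_infinitePi_of_inj (P := fun _ : ℕ => μ) (add_right_injective m)

lemma real_preimage_shift (m : ℕ) {S : Set (ℕ → E)} (hS : MeasurableSet S) :
    (seqLaw μ).real (shift m ⁻¹' S) = (seqLaw μ).real S := by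
  rw [← map_measureReal_apply (measurable_shift m) hS, map_shift]

variable [AddCommGroup E]

lemma indepFun_past_shift (m : ℕ) :
    IndepFun (past m : (ℕ → E) → ℕ → E) (shift m) (seqLaw μ) := by
  have hcoord : iIndepFun (fun (i : ℕ) (e : ℕ → E) => e i) (seqLaw μ) :=
    iIndepFun_infinitePi (X := fun _ z => z) fun _ => measurable_id
  have hrestrict : IndepFun (fun (e : ℕ → E) (i : Finset.range m) => e i) (shift m)
      (seqLaw μ) := by
    refine IndepFun.indepFun_process (by fun_prop) (fun i => measurable_pi_apply (m + i))
      fun I => ?_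
    have hdisj : Disjoint (Finset.range m) (I.map (addLeftEmbedding m)) := by
      simp only [Finset.disjoint_left, Finset.mem_range, Finset.mem_map, addLeftEmbedding_apply]
      omega
    exact (hcoord.indepFun_finset _ _ hdisj measurable_pi_apply).comp measurable_id
      (ψ := fun f (i : I) => f ⟨m + i, Finset.mem_map_of_mem (addLeftEmbedding m) i.2⟩)
      (by fun_prop)
  exact hrestrict.comp
    (φ := fun f i => if h : i < m then f ⟨i, Finset.mem_range.2 h⟩ else 0)
    (measurable_pi_lambda _ fun i => by split_ifs <;> fun_prop) measurable_id

lemma real_inter_preimage_shift {m : ℕ} {B C : Set (ℕ → E)} (hB : MeasurableSet B)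
    (hBm : past m ⁻¹' B = B) (hC : MeasurableSet C) :
    (seqLaw μ).real (B ∩ shift m ⁻¹' C) = (seqLaw μ).real B * (seqLaw μ).real C := by
  have hindep := (indepFun_past_shift μ m).measure_inter_preimage_eq_mul B C hB hC
  rw [hBm] at hindep
  rw [← real_preimage_shift μ m hC, measureReal_def, hindep, ENNReal.toReal_mul]
  rfl

lemma real_forall_shift_mem {H : ℕ} {S : Set (ℕ → E)} (hS : MeasurableSet S)
    (hSH : past H ⁻¹' S = S) (M : ℕ) :
    (seqLaw μ).real {e | ∀ i < M, shift (i * H) e ∈ S} = (seqLaw μ).real S ^ M := by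
  induction M with
  | zero => simp
  | succ M ih =>
    have hsplit : {e | ∀ i < M + 1, shift (i * H) e ∈ S} =
        S ∩ shift H ⁻¹' {e | ∀ i < M, shift (i * H) e ∈ S} := by
      ext e
      simp only [Set.mem_ofPred_eq, Set.mem_inter_iff, Set.mem_preimage, Nat.forall_lt_succ_left,
        zero_mul, shift_zero, shift_shift, add_mul, one_mul, add_comm]
    have hmeas : MeasurableSet {e : ℕ → E | ∀ i < M, shift (i * H) e ∈ S} := by
      simp only [Set.ofPred_forall]
      exact .iInter fun i => .iInter fun _ => measurable_shift (i * H) hS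
    rw [hsplit, real_inter_preimage_shift μ hS hSH hmeas, ih, pow_succ']

lemma map_head_shift : (seqLaw μ).map (fun e => (e 0, shift 1 e)) = μ.prod (seqLaw μ) := by
  have hindep : IndepFun (fun e : ℕ → E => e 0) (shift 1) (seqLaw μ) :=
    (indepFun_past_shift μ 1).comp (φ := fun e : ℕ → E => e 0) (ψ := id)
      (measurable_pi_apply 0) measurable_id
  rw [(indepFun_iff_map_prod_eq_prod_map_map (measurable_pi_apply 0).aemeasurable
    (measurable_shift 1).aemeasurable).1 hindep, map_shift, Measure.infinitePi_map_eval]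

variable [Countable E] [DiscreteMeasurableSpace E]

lemma real_shift_one_mem {D : E → Set (ℕ → E)} (hD : ∀ z, MeasurableSet (D z)) :
    (seqLaw μ).real {e | shift 1 e ∈ D (e 0)} = ∫ z, (seqLaw μ).real (D z) ∂μ := by
  have hmeas : MeasurableSet {q : E × (ℕ → E) | q.2 ∈ D q.1} :=
    measurableSet_setOfPred.2 <| measurable_from_prod_countable_right fun z =>
      measurableSet_setOfPred.1 (hD z)
  have hpre : {e : ℕ → E | shift 1 e ∈ D (e 0)} =
      (fun e => (e 0, shift 1 e)) ⁻¹' {q | q.2 ∈ D q.1} := rfl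
  rw [hpre, ← map_measureReal_apply (by fun_prop) hmeas, map_head_shift, measureReal_def,
    Measure.prod_apply hmeas, integral_eq_lintegral_of_nonneg_ae (ae_of_all _ fun _ =>
      measureReal_nonneg) Measurable.of_discrete.aestronglyMeasurable]
  simp only [ofReal_measureReal (measure_ne_top _ _), Set.preimage_ofPred_eq, Set.ofPred_mem_eq]

@[fun_prop]
lemma measurable_walk (j : ℕ) : Measurable fun e : ℕ → E => walk e j := by
  have : MeasurableAdd₂ E := ⟨Measurable.of_discrete⟩
  exact Finset.measurable_sum _ fun i _ => measurable_pi_apply i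

lemma measurableSet_walk_eq (j : ℕ) (x : E) : MeasurableSet {e : ℕ → E | walk e j = x} :=
  measurable_walk j (measurableSet_singleton x)

lemma measurable_visits (A : Set E) (x : E) (n : ℕ) :
    Measurable fun e : ℕ → E => visits A x e n :=
  Finset.measurable_sum _ fun j _ =>
    (Measurable.of_discrete (f := fun y : E => A.indicator (1 : E → ℕ) (x + y))).comp
      (measurable_walk j)

lemma measurableSet_le_visits (A : Set E) (n : ℕ) (x : E) (k : ℕ) :
    MeasurableSet {e : ℕ → E | k ≤ visits A x e n} :=
  measurable_visits A x n measurableSet_Ici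

end SequenceLaw

section TransitionProb

variable {E : Type*} [AddCommGroup E] [MeasurableSpace E] (μ : Measure E)

/-- The probability that the walk with step law `μ` started at `0` is at `x` at time `j`. -/
def transitionProb (j : ℕ) (x : E) : ℝ := (seqLaw μ).real {e | walk e j = x}

lemma transitionProb_nonneg (j : ℕ) (x : E) : 0 ≤ transitionProb μ j x := measureReal_nonneg

variable [IsProbabilityMeasure μ]

lemma transitionProb_zero [DecidableEq E] (x : E) :
    transitionProb μ 0 x = if x = 0 then 1 else 0 := by
  split_ifs with hx <;> simp [transitionProb, hx, eq_comm]

lemma transitionProb_mem_Icc (j : ℕ) (x : E) : transitionProb μ j x ∈ Set.Icc 0 1 :=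
  ⟨measureReal_nonneg, measureReal_le_one⟩

omit [AddCommGroup E] in
lemma ae_real_singleton_pos [Countable E] : ∀ᵐ z ∂μ, 0 < μ.real {z} := by
  rw [ae_iff, ← Set.biUnion_of_singleton {z | ¬0 < μ.real {z}},
    measure_biUnion_null_iff (Set.to_countable _)]
  exact fun z hz => (measureReal_eq_zero_iff).1 (le_antisymm (not_lt.1 hz) measureReal_nonneg)

variable [DiscreteMeasurableSpace E]

lemma integrable_transitionProb (j : ℕ) (f : E → E) :
    Integrable (fun z => transitionProb μ j (f z)) μ :=
  .of_mem_Icc 0 1 Measurable.of_discrete.aemeasurable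
    (ae_of_all _ fun z => transitionProb_mem_Icc μ j (f z))

variable [Countable E]

lemma transitionProb_succ (j : ℕ) (x : E) :
    transitionProb μ (j + 1) x = ∫ z, transitionProb μ j (x - z) ∂μ := by
  rw [transitionProb]
  simp only [walk_succ, ← eq_sub_iff_add_eq']
  exact real_shift_one_mem μ fun z => measurableSet_walk_eq j (x - z)

lemma real_walk_eq_inter_preimage_shift (n : ℕ) (x : E) {C : Set (ℕ → E)} (hC : MeasurableSet C) :
    (seqLaw μ).real ({e | walk e n = x} ∩ shift n ⁻¹' C) =
      transitionProb μ n x * (seqLaw μ).real C :=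
  real_inter_preimage_shift μ (measurableSet_walk_eq n x)
    (by simp only [Set.preimage_ofPred_eq, walk_past le_rfl]) hC

lemma transitionProb_mul_le (n j : ℕ) (x y : E) :
    transitionProb μ n x * transitionProb μ j y ≤ transitionProb μ (n + j) (x + y) := by
  rw [transitionProb.eq_1 μ j,
    ← real_walk_eq_inter_preimage_shift μ n x (measurableSet_walk_eq j y)]
  refine measureReal_mono ?_
  rintro e ⟨rfl, rfl⟩
  exact walk_add e n j

lemma transitionProb_one (z : E) : transitionProb μ 1 z = μ.real {z} := by
  classical
  rw [transitionProb_succ, ← integral_indicator_one (measurableSet_singleton z)]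
  simp only [transitionProb_zero, sub_eq_zero, Set.indicator_apply, Set.mem_singleton_iff,
    Pi.one_apply, eq_comm]

section Symmetric

variable [μ.IsNegInvariant]

lemma transitionProb_neg (j : ℕ) (x : E) : transitionProb μ j (-x) = transitionProb μ j x := by
  classical
  induction j generalizing x with
  | zero => simp only [transitionProb_zero, neg_eq_zero]
  | succ j ih =>
    rw [transitionProb_succ, transitionProb_succ, ← integral_neg_eq_self]
    refine integral_congr_ae (ae_of_all _ fun z => ?_)
    simp only [← ih (x - z), neg_sub, sub_neg_eq_add, neg_add_eq_sub]

lemma transitionProb_two_zero_pos : 0 < transitionProb μ 2 0 := by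
  obtain ⟨z, hz⟩ := (ae_real_singleton_pos μ).exists
  rw [← transitionProb_one] at hz
  have hreturn := transitionProb_mul_le μ 1 1 z (-z)
  rw [transitionProb_neg, add_neg_cancel] at hreturn
  exact (mul_pos hz hz).trans_le hreturn

variable {μ}

lemma exists_transitionProb_pos (hgen : AddSubgroup.closure {z | 0 < μ.real {z}} = ⊤) (x : E) :
    ∃ j, 0 < transitionProb μ j x := by
  classical
  have hstep : ∀ z y, 0 < transitionProb μ 1 z → (∃ j, 0 < transitionProb μ j y) →
      ∃ j, 0 < transitionProb μ j (z + y) := fun z y hz ⟨j, hj⟩ =>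
    ⟨1 + j, (mul_pos hz hj).trans_le (transitionProb_mul_le μ 1 j z y)⟩
  simp only [← transitionProb_one] at hgen
  have hx : x ∈ AddSubgroup.closure {z | 0 < transitionProb μ 1 z} := hgen ▸ AddSubgroup.mem_top x
  induction hx using AddSubgroup.closure_induction_left with
  | zero => exact ⟨0, by simp [transitionProb_zero]⟩
  | add_left z hz y _ ih => exact hstep z y hz ih
  | neg_add_cancel z hz y _ ih => exact hstep (-z) y (by rwa [transitionProb_neg]) ih

end Symmetric

end TransitionProb

section Transience

variable {E : Type*} [AddCommGroup E]

/-- The event that the walk started at `0` visits the origin for the last time at time `n`. -/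
def lastVisit (E : Type*) [AddCommGroup E] (n : ℕ) : Set (ℕ → E) :=
  {e | walk e n = 0 ∧ ∀ j > n, walk e j ≠ 0}

lemma lastVisit_eq_inter (n : ℕ) :
    lastVisit E n = {e | walk e n = 0} ∩ shift n ⁻¹' lastVisit E 0 := by
  ext e
  refine and_congr_right fun h0 => ?_
  simp only [Set.mem_preimage, lastVisit, Set.mem_ofPred_eq, walk_zero, true_and]
  refine ⟨fun h j hj => ?_, fun h j hj => ?_⟩
  · simpa [walk_add, h0] using h (n + j) (by omega)
  · obtain ⟨i, rfl⟩ := Nat.exists_eq_add_of_lt hj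
    simpa [add_assoc, walk_add, h0] using h (i + 1) i.succ_pos

lemma pairwise_disjoint_lastVisit : Pairwise (Function.onFun Disjoint (lastVisit E)) :=
  (pairwise_disjoint_on _).2 fun _ n hmn =>
    Set.disjoint_left.2 fun _ hm hn => hm.2 n hmn hn.1

lemma iUnion_lastVisit : ⋃ n, lastVisit E n = {e | {n | walk e n = 0}.Finite} := by
  ext e
  simp only [Set.mem_iUnion, Set.mem_ofPred_eq]
  refine ⟨fun ⟨n, hn⟩ => (Set.finite_Iic n).subset fun j hj => ?_, fun hfin => ?_⟩
  · exact not_lt.1 fun hlt => hn.2 j hlt hj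
  · obtain ⟨n, hn, hmax⟩ := hfin.exists_maximal ⟨0, walk_zero e⟩
    exact ⟨n, hn, fun j hlt hj => hlt.not_ge (hmax hj hlt.le)⟩

variable [Countable E] [MeasurableSpace E] [DiscreteMeasurableSpace E]

lemma measurableSet_lastVisit (n : ℕ) : MeasurableSet (lastVisit E n) := by
  simp only [lastVisit, Set.ofPred_and, Set.ofPred_forall]
  exact (measurableSet_walk_eq n 0).inter <|
    .iInter fun j => .iInter fun _ => (measurableSet_walk_eq j 0).compl

lemma measurableSet_finite_walk_eq_zero :
    MeasurableSet {e : ℕ → E | {n | walk e n = 0}.Finite} :=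
  iUnion_lastVisit (E := E) ▸ .iUnion measurableSet_lastVisit

variable {μ : Measure E} [IsProbabilityMeasure μ]

lemma real_lastVisit (n : ℕ) :
    (seqLaw μ).real (lastVisit E n) = transitionProb μ n 0 * (seqLaw μ).real (lastVisit E 0) := by
  rw [lastVisit_eq_inter, real_walk_eq_inter_preimage_shift μ n 0 (measurableSet_lastVisit 0)]

lemma real_lastVisit_zero_pos (htrans : ∀ᵐ e ∂seqLaw μ, {n | walk e n = 0}.Finite) :
    0 < (seqLaw μ).real (lastVisit E 0) := by
  refine measureReal_nonneg.lt_of_ne' fun h0 => ?_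
  have hnull : seqLaw μ (⋃ n, lastVisit E n) = 0 := measure_iUnion_null fun n =>
    (measureReal_eq_zero_iff).1 (by rw [real_lastVisit, h0, mul_zero])
  obtain ⟨e, hfin, hmem⟩ := (htrans.and (measure_eq_zero_iff_ae_notMem.1 hnull)).exists
  exact hmem (iUnion_lastVisit (E := E) ▸ hfin)

/- The last-visit events are disjoint, and the `n`-th one has probability proportional to
`transitionProb μ n 0`. -/
lemma summable_transitionProb_zero (htrans : ∀ᵐ e ∂seqLaw μ, {n | walk e n = 0}.Finite) :
    Summable fun n => transitionProb μ n 0 := by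
  have hsum : Summable fun n => (seqLaw μ).real (lastVisit E n) := by
    refine ENNReal.summable_toReal ?_
    rw [← measure_iUnion pairwise_disjoint_lastVisit measurableSet_lastVisit]
    exact measure_ne_top _ _
  exact (summable_mul_right_iff (real_lastVisit_zero_pos htrans).ne').1
    (hsum.congr real_lastVisit)

lemma summable_transitionProb [μ.IsNegInvariant]
    (hgen : AddSubgroup.closure {z | 0 < μ.real {z}} = ⊤)
    (htrans : ∀ᵐ e ∂seqLaw μ, {n | walk e n = 0}.Finite) (x : E) :
    Summable fun n => transitionProb μ n x := by
  obtain ⟨j, hj⟩ := exists_transitionProb_pos hgen (-x)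
  have hbound : Summable fun n => transitionProb μ (n + j) 0 :=
    (summable_transitionProb_zero htrans).comp_injective (add_left_injective j)
  have hle : ∀ n, transitionProb μ n x * transitionProb μ j (-x) ≤ transitionProb μ (n + j) 0 :=
    fun n => (transitionProb_mul_le μ n j x (-x)).trans_eq (by rw [add_neg_cancel])
  have hmul : Summable fun n => transitionProb μ n x * transitionProb μ j (-x) :=
    .of_nonneg_of_le (fun n => mul_nonneg (transitionProb_nonneg μ n x) hj.le) hle hbound
  exact (summable_mul_right_iff hj.ne').1 hmul

end Transience

section VisitTail

variable {E : Type*} [AddCommGroup E] [MeasurableSpace E] (μ : Measure E) (A : Set E)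

/-- The probability that the walk with step law `μ` started at `x` visits `A` at least `k` times
strictly before time `n`. -/
def visitTail (n : ℕ) (x : E) (k : ℕ) : ℝ := (seqLaw μ).real {e | k ≤ visits A x e n}

lemma visitTail_nonneg (n : ℕ) (x : E) (k : ℕ) : 0 ≤ visitTail μ A n x k := measureReal_nonneg

lemma visitTail_zero_succ (x : E) (k : ℕ) : visitTail μ A 0 x (k + 1) = 0 := by
  simp [visitTail]

variable [IsProbabilityMeasure μ]

lemma visitTail_le_one (n : ℕ) (x : E) (k : ℕ) : visitTail μ A n x k ≤ 1 := measureReal_le_one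

lemma visitTail_zero_right (n : ℕ) (x : E) : visitTail μ A n x 0 = 1 := by
  simp [visitTail]

variable [DiscreteMeasurableSpace E]

lemma integrable_visitTail (n : ℕ) (x : E) (k : ℕ) :
    Integrable (fun z => visitTail μ A n (x + z) k) μ :=
  .of_mem_Icc 0 1 Measurable.of_discrete.aemeasurable
    (ae_of_all _ fun z => ⟨visitTail_nonneg μ A n (x + z) k, visitTail_le_one μ A n (x + z) k⟩)

variable [Countable E] {A} {x : E}

lemma visitTail_succ_of_notMem (hx : x ∉ A) (n k : ℕ) :
    visitTail μ A (n + 1) x k = ∫ z, visitTail μ A n (x + z) k ∂μ := by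
  simp only [visitTail, visits_succ, Set.indicator_of_notMem hx, zero_add]
  exact real_shift_one_mem μ fun z => measurableSet_le_visits A n (x + z) k

lemma visitTail_succ_of_mem (hx : x ∈ A) (n k : ℕ) :
    visitTail μ A (n + 1) x (k + 1) = ∫ z, visitTail μ A n (x + z) k ∂μ := by
  simp only [visitTail, visits_succ, Set.indicator_of_mem hx, Pi.one_apply, add_comm k,
    add_le_add_iff_left]
  exact real_shift_one_mem μ fun z => measurableSet_le_visits A n (x + z) k

lemma visitTail_succ_one_of_mem (hx : x ∈ A) (n : ℕ) : visitTail μ A (n + 1) x 1 = 1 := by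
  simp [visitTail_succ_of_mem μ hx n 0, visitTail_zero_right]

end VisitTail

section Potential

variable {E : Type*} [AddCommGroup E] [MeasurableSpace E] (μ : Measure E) (A : Finset E)
  (v : E → ℝ)

/-- The potential of the charge `v` on `A` truncated at time `n`: the expected sum of `v` over the
visits to `A` strictly before time `n` of the walk started at `x`. -/
def potential (n : ℕ) (x : E) : ℝ :=
  ∑ j ∈ Finset.range n, ∑ y ∈ A, v y * transitionProb μ j (y - x)

lemma potential_zero (x : E) : potential μ A v 0 x = 0 := Finset.sum_range_zero _

section Order

variable {v} (hv : ∀ x ∈ A, 0 ≤ v x) (x : E)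
include hv

variable {A} in
lemma monotone_potential : Monotone fun n => potential μ A v n x := fun _ _ h =>
  Finset.sum_le_sum_of_subset_of_nonneg (Finset.range_mono h) fun j _ _ =>
    Finset.sum_nonneg fun y hy => mul_nonneg (hv y hy) (transitionProb_nonneg μ j _)

variable {A} in
lemma sum_mul_transitionProb_le_potential {y : E} (hy : y ∈ A) (n : ℕ) :
    ∑ j ∈ Finset.range n, v y * transitionProb μ j (y - x) ≤ potential μ A v n x :=
  Finset.sum_le_sum fun j _ =>
    Finset.single_le_sum (f := fun y => v y * transitionProb μ j (y - x))
      (fun y hy => mul_nonneg (hv y hy) (transitionProb_nonneg μ j _)) hy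

end Order

lemma tendsto_potential {x : E} (hsum : ∀ y, Summable fun j => transitionProb μ j y) :
    Tendsto (fun n => potential μ A v n x) atTop
      (𝓝 (∑ y ∈ A, v y * ∑' j, transitionProb μ j (y - x))) :=
  (hasSum_sum fun y _ => (hsum (y - x)).hasSum.mul_left (v y)).tendsto_sum_nat

variable [IsProbabilityMeasure μ] [DiscreteMeasurableSpace E]

lemma integrable_potential (n : ℕ) (x : E) : Integrable (fun z => potential μ A v n (x + z)) μ :=
  integrable_finsetSum _ fun j _ => integrable_finsetSum _ fun y _ =>
    (integrable_transitionProb μ j fun z => y - (x + z)).const_mul (v y)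

variable [Countable E]

lemma potential_succ (n : ℕ) (x : E) :
    potential μ A v (n + 1) x =
      (A : Set E).indicator v x + ∫ z, potential μ A v n (x + z) ∂μ := by
  classical
  have hzero : ∑ y ∈ A, v y * transitionProb μ 0 (y - x) = (A : Set E).indicator v x := by
    simp [transitionProb_zero, sub_eq_zero, Set.indicator_apply]
  have hint : ∀ j y, Integrable (fun z => v y * transitionProb μ j (y - (x + z))) μ := fun j y =>
    (integrable_transitionProb μ j fun z => y - (x + z)).const_mul (v y)
  simp only [potential]
  rw [Finset.sum_range_succ', hzero, add_comm,
    integral_finsetSum _ fun j _ => integrable_finsetSum _ fun y _ => hint j y]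
  simp only [integral_finsetSum _ fun y _ => hint _ y, integral_const_mul, transitionProb_succ,
    sub_sub]

variable {A v}

lemma potential_succ_of_notMem {x : E} (hx : x ∉ A) (n : ℕ) :
    potential μ A v (n + 1) x = ∫ z, potential μ A v n (x + z) ∂μ := by
  rw [potential_succ, Set.indicator_of_notMem (Finset.mem_coe.not.2 hx), zero_add]

lemma potential_succ_sub_of_mem {x : E} (hx : x ∈ A) (n : ℕ) :
    potential μ A v (n + 1) x - v x = ∫ z, potential μ A v n (x + z) ∂μ := by
  rw [potential_succ, Set.indicator_of_mem (Finset.mem_coe.2 hx), add_sub_cancel_left]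

lemma le_potential_succ_of_mem (hv : ∀ x ∈ A, 0 ≤ v x) {x : E} (hx : x ∈ A) (n : ℕ) :
    v x ≤ potential μ A v (n + 1) x := by
  refine le_trans ?_ (monotone_potential μ hv x (Nat.le_add_left 1 n))
  exact (sub_nonneg.1 ((potential_succ_sub_of_mem μ hx 0).symm ▸ by simp [potential_zero]))

lemma visitTail_le {C ρ : ℝ} (hv : ∀ x ∈ A, 0 ≤ v x) (hC : 0 ≤ C) (hρ : 0 ≤ ρ)
    (hCv : ∀ x ∈ A, 1 ≤ C * v x)
    (hpot : ∀ n, ∀ x ∈ A, potential μ A v n x - v x ≤ ρ * potential μ A v n x)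
    (n : ℕ) (x : E) (k : ℕ) :
    visitTail μ A n x (k + 1) ≤ C * ρ ^ k * potential μ A v n x := by
  induction n generalizing x k with
  | zero => rw [visitTail_zero_succ, potential_zero, mul_zero]
  | succ n ih =>
    have hint (k : ℕ) : ∫ z, visitTail μ A n (x + z) (k + 1) ∂μ ≤
        C * ρ ^ k * ∫ z, potential μ A v n (x + z) ∂μ := by
      rw [← integral_const_mul]
      exact integral_mono (integrable_visitTail μ A n x (k + 1))
        ((integrable_potential μ A v n x).const_mul _) fun z => ih (x + z) k
    by_cases hx : x ∈ A
    · cases k with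
      | zero =>
        calc visitTail μ A (n + 1) x 1 ≤ 1 := visitTail_le_one μ A (n + 1) x 1
          _ ≤ C * v x := hCv x hx
          _ ≤ C * ρ ^ 0 * potential μ A v (n + 1) x := by
            rw [pow_zero, mul_one]
            exact mul_le_mul_of_nonneg_left (le_potential_succ_of_mem μ hv hx n) hC
      | succ k =>
        calc visitTail μ A (n + 1) x (k + 2)
            = ∫ z, visitTail μ A n (x + z) (k + 1) ∂μ :=
              visitTail_succ_of_mem μ (Finset.mem_coe.2 hx) n (k + 1)
          _ ≤ C * ρ ^ k * (potential μ A v (n + 1) x - v x) :=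
            (hint k).trans_eq (by rw [potential_succ_sub_of_mem μ hx])
          _ ≤ C * ρ ^ k * (ρ * potential μ A v (n + 1) x) := by
            gcongr
            exact hpot (n + 1) x hx
          _ = C * ρ ^ (k + 1) * potential μ A v (n + 1) x := by ring
    · rw [visitTail_succ_of_notMem μ (Finset.mem_coe.not.2 hx), potential_succ_of_notMem μ hx]
      exact hint k

/- Outside `A` both sides solve the same recursion in `s`. -/
lemma mul_potential_le_visitTail_of_mem {b : ℝ} {k N : ℕ}
    (h : ∀ s, ∀ x ∈ A, b * potential μ A v s x ≤ visitTail μ A (N + s) x k) (s : ℕ) (x : E) :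
    b * potential μ A v s x ≤ visitTail μ A (N + s) x k := by
  induction s generalizing x with
  | zero =>
    rw [potential_zero, mul_zero]
    exact visitTail_nonneg μ A N x k
  | succ s ih =>
    by_cases hx : x ∈ A
    · exact h (s + 1) x hx
    rw [potential_succ_of_notMem μ hx, ← add_assoc,
      visitTail_succ_of_notMem μ (Finset.mem_coe.not.2 hx), ← integral_const_mul]
    exact integral_mono ((integrable_potential μ A v s x).const_mul _)
      (integrable_visitTail μ A (N + s) x k) fun z => ih (x + z)

lemma le_visitTail {c r : ℝ} {T : ℕ} (hc : 0 ≤ c) (hr : 0 ≤ r)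
    (hcv : ∀ s, ∀ x ∈ A, c * potential μ A v s x ≤ 1)
    (hpot : ∀ s, ∀ x ∈ A, r * potential μ A v s x ≤ potential μ A v (T + s + 1) x - v x)
    (k s : ℕ) (x : E) :
    c * r ^ k * potential μ A v s x ≤ visitTail μ A (k * (T + 1) + s) x (k + 1) := by
  induction k generalizing s x with
  | zero =>
    refine mul_potential_le_visitTail_of_mem μ (fun s x hx => ?_) s x
    rw [zero_mul, zero_add, zero_add, pow_zero, mul_one]
    cases s with
    | zero => rw [potential_zero, mul_zero, visitTail_zero_succ μ A x 0]
    | succ s =>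
      rw [visitTail_succ_one_of_mem μ (Finset.mem_coe.2 hx)]
      exact hcv (s + 1) x hx
  | succ k ih =>
    refine mul_potential_le_visitTail_of_mem μ (fun s x hx => ?_) s x
    have htime : (k + 1) * (T + 1) + s = k * (T + 1) + (T + s) + 1 := by ring
    calc c * r ^ (k + 1) * potential μ A v s x
        = c * r ^ k * (r * potential μ A v s x) := by ring
      _ ≤ c * r ^ k * (potential μ A v (T + s + 1) x - v x) := by
        gcongr
        exact hpot s x hx
      _ = ∫ z, c * r ^ k * potential μ A v (T + s) (x + z) ∂μ := by
        rw [potential_succ_sub_of_mem μ hx, integral_const_mul]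
      _ ≤ ∫ z, visitTail μ A (k * (T + 1) + (T + s)) (x + z) (k + 1) ∂μ :=
        integral_mono ((integrable_potential μ A v (T + s) x).const_mul _)
          (integrable_visitTail μ A _ x (k + 1)) fun z => ih (T + s) (x + z)
      _ = visitTail μ A ((k + 1) * (T + 1) + s) x (k + 1 + 1) := by
        rw [htime, visitTail_succ_of_mem μ (Finset.mem_coe.2 hx)]

end Potential

section PotentialMatrix

variable {E : Type*} [AddCommGroup E] [MeasurableSpace E]

/-- The Green matrix on `A` of the walk with step law `μ`. -/
def potentialMatrix (μ : Measure E) (A : Finset E) : Matrix A A ℝ :=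
  Matrix.of fun x y => ∑' k, transitionProb μ k (x.1 - y.1)

variable [Countable E] [DiscreteMeasurableSpace E] {μ : Measure E} [IsProbabilityMeasure μ]
  {A : Finset E} {v : E → ℝ} {L : ℝ}

lemma exists_pos_tendsto_potential [DecidableEq E] [μ.IsNegInvariant]
    (hgen : AddSubgroup.closure {z | 0 < μ.real {z}} = ⊤)
    (hsum : ∀ x, Summable fun j => transitionProb μ j x) (hA : A.Nonempty) :
    ∃ v : E → ℝ, (∀ x ∈ A, 0 < v x) ∧ ∀ x ∈ A, Tendsto (fun n => potential μ A v n x) atTop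
      (𝓝 (largestEigenvalue (potentialMatrix μ A) * v x)) := by
  have hgreen_neg (x y : E) :
      ∑' k, transitionProb μ k (y - x) = ∑' k, transitionProb μ k (x - y) :=
    tsum_congr fun k => by rw [← transitionProb_neg, neg_sub]
  have hpos (i j : A) : 0 < potentialMatrix μ A i j := by
    obtain ⟨k, hk⟩ := exists_transitionProb_pos hgen (i.1 - j.1)
    exact (hsum _).tsum_pos (fun k => transitionProb_nonneg μ k _) k hk
  have : Nonempty A := hA.to_subtype
  obtain ⟨v, hv, heigen⟩ := exists_pos_eigenvector
    (Matrix.IsHermitian.ext fun i j => hgreen_neg i.1 j.1) hpos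
  have hextend (y : A) : Function.extend Subtype.val v 0 y.1 = v y :=
    Subtype.val_injective.extend_apply v 0 y
  refine ⟨Function.extend Subtype.val v 0, fun x hx => (hextend ⟨x, hx⟩).symm ▸ hv _,
    fun x hx => ?_⟩
  have hlim := tendsto_potential μ A (Function.extend Subtype.val v 0) (x := x) hsum
  rw [← Finset.sum_coe_sort] at hlim
  convert hlim using 2
  rw [hextend ⟨x, hx⟩]
  refine (congrFun heigen ⟨x, hx⟩).symm.trans (Finset.sum_congr rfl fun y _ => ?_)
  rw [hextend, hgreen_neg, mul_comm]
  rfl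

lemma one_lt_of_tendsto_potential [μ.IsNegInvariant] (hA : A.Nonempty) (hv : ∀ x ∈ A, 0 < v x)
    (hlim : ∀ x ∈ A, Tendsto (fun n => potential μ A v n x) atTop (𝓝 (L * v x))) : 1 < L := by
  classical
  obtain ⟨x, hx⟩ := hA
  have hv0 (y : E) (hy : y ∈ A) : 0 ≤ v y := (hv y hy).le
  have hupper : potential μ A v 3 x ≤ L * v x :=
    (monotone_potential μ hv0 x).ge_of_tendsto (hlim x hx) 3
  have hlower := sum_mul_transitionProb_le_potential μ hv0 x hx 3
  simp only [Finset.sum_range_succ, Finset.sum_range_zero, sub_self, transitionProb_zero, if_true,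
    mul_one, zero_add] at hlower
  have hone := mul_nonneg (hv0 x hx) (transitionProb_nonneg μ 1 0)
  have htwo := mul_pos (hv x hx) (transitionProb_two_zero_pos μ)
  refine lt_of_mul_lt_mul_right ?_ (hv0 x hx)
  linarith

lemma exists_visitTail_le (hv : ∀ x ∈ A, 0 < v x) (hL : 1 < L)
    (hlim : ∀ x ∈ A, Tendsto (fun n => potential μ A v n x) atTop (𝓝 (L * v x))) :
    ∃ C, ∀ n, ∀ a ∈ A, ∀ k, visitTail μ A n a (k + 1) ≤ C * (1 - 1 / L) ^ k := by
  have hL0 : 0 < L := one_pos.trans hL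
  have hρ : 0 ≤ 1 - 1 / L := sub_nonneg.2 ((div_le_one hL0).2 hL.le)
  have hv0 (x : E) (hx : x ∈ A) : 0 ≤ v x := (hv x hx).le
  have hpot (n : ℕ) (x : E) (hx : x ∈ A) : potential μ A v n x ≤ L * v x :=
    (monotone_potential μ hv0 x).ge_of_tendsto (hlim x hx) n
  have hC : 0 ≤ ∑ x ∈ A, (v x)⁻¹ := Finset.sum_nonneg fun x hx => inv_nonneg.2 (hv0 x hx)
  have hCv (x : E) (hx : x ∈ A) : 1 ≤ (∑ x ∈ A, (v x)⁻¹) * v x := by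
    rw [← div_le_iff₀ (hv x hx), one_div]
    exact Finset.single_le_sum (f := fun x => (v x)⁻¹) (fun y hy => inv_nonneg.2 (hv0 y hy)) hx
  have hgrowth (n : ℕ) (x : E) (hx : x ∈ A) :
      potential μ A v n x - v x ≤ (1 - 1 / L) * potential μ A v n x := by
    have := (div_le_iff₀' hL0).2 (hpot n x hx)
    linarith [one_div_mul_eq_div L (potential μ A v n x)]
  refine ⟨(∑ x ∈ A, (v x)⁻¹) * (L * ∑ x ∈ A, v x), fun n a ha k => ?_⟩
  have hsum : potential μ A v n a ≤ L * ∑ x ∈ A, v x :=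
    (hpot n a ha).trans (mul_le_mul_of_nonneg_left (Finset.single_le_sum hv0 ha) hL0.le)
  calc visitTail μ A n a (k + 1)
      ≤ (∑ x ∈ A, (v x)⁻¹) * (1 - 1 / L) ^ k * potential μ A v n a :=
        visitTail_le μ hv0 hC hρ hCv hgrowth n a k
    _ ≤ (∑ x ∈ A, (v x)⁻¹) * (1 - 1 / L) ^ k * (L * ∑ x ∈ A, v x) := by gcongr
    _ = (∑ x ∈ A, (v x)⁻¹) * (L * ∑ x ∈ A, v x) * (1 - 1 / L) ^ k := by ring

lemma exists_potential_pos [μ.IsNegInvariant]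
    (hgen : AddSubgroup.closure {z | 0 < μ.real {z}} = ⊤) (hA : A.Nonempty)
    (hv : ∀ x ∈ A, 0 < v x) (x : E) : ∃ s, 0 < potential μ A v s x := by
  obtain ⟨a, ha⟩ := hA
  obtain ⟨s, hs⟩ := exists_transitionProb_pos hgen (a - x)
  refine ⟨s + 1, lt_of_lt_of_le ?_
    (sum_mul_transitionProb_le_potential μ (fun y hy => (hv y hy).le) x ha (s + 1))⟩
  exact Finset.sum_pos' (fun j _ => mul_nonneg (hv a ha).le (transitionProb_nonneg μ j _))
    ⟨s, Finset.self_mem_range_succ s, mul_pos (hv a ha) hs⟩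

lemma exists_le_visitTail [μ.IsNegInvariant]
    (hgen : AddSubgroup.closure {z | 0 < μ.real {z}} = ⊤) (hA : A.Nonempty)
    (hv : ∀ x ∈ A, 0 < v x) (hL : 1 < L)
    (hlim : ∀ x ∈ A, Tendsto (fun n => potential μ A v n x) atTop (𝓝 (L * v x)))
    {r : ℝ} (hr0 : 0 < r) (hr : r < 1 - 1 / L) :
    ∃ b > 0, ∃ T s : ℕ, ∀ k, b * r ^ k ≤ visitTail μ A (k * T + s) 0 (k + 1) := by
  have hL0 : 0 < L := one_pos.trans hL
  have hv0 (x : E) (hx : x ∈ A) : 0 ≤ v x := (hv x hx).le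
  have hpot (n : ℕ) (x : E) (hx : x ∈ A) : potential μ A v n x ≤ L * v x :=
    (monotone_potential μ hv0 x).ge_of_tendsto (hlim x hx) n
  have hev : ∀ᶠ n in atTop, ∀ x ∈ A, r * (L * v x) + v x ≤ potential μ A v n x := by
    refine (Finset.eventually_all A).2 fun x hx => (hlim x hx).eventually_const_le ?_
    have hlt := mul_lt_mul_of_pos_right hr (mul_pos hL0 (hv x hx))
    rw [sub_mul, one_mul, ← mul_assoc (1 / L), one_div_mul_cancel hL0.ne'] at hlt
    linarith
  obtain ⟨T, hT⟩ := eventually_atTop.1 hev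
  obtain ⟨s, hs⟩ := exists_potential_pos hgen hA hv 0
  have hV : 0 < L * ∑ x ∈ A, v x := mul_pos hL0 (Finset.sum_pos hv hA)
  refine ⟨(L * ∑ x ∈ A, v x)⁻¹ * potential μ A v s 0, by positivity, T + 1, s, fun k => ?_⟩
  rw [mul_right_comm]
  refine le_visitTail μ (inv_nonneg.2 hV.le) hr0.le (fun n x hx => ?_) (fun n x hx => ?_) k s 0
  · rw [inv_mul_le_one₀ hV]
    exact (hpot n x hx).trans (mul_le_mul_of_nonneg_left (Finset.single_le_sum hv0 hx) hL0.le)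
  · have hle := mul_le_mul_of_nonneg_left (hpot n x hx) hr0.le
    linarith [hT (T + n + 1) (by omega) x hx]

end PotentialMatrix

section LogScale

variable {c : ℝ} (hc : 0 < c)
include hc

lemma exp_one_div_mul_lt_one {ρ : ℝ} (hρ0 : 0 < ρ) (hρ1 : ρ < 1) (h : -1 / Real.log ρ < c) :
    Real.exp (1 / c) * ρ < 1 := by
  rw [div_lt_iff_of_neg (Real.log_neg hρ0 hρ1)] at h
  rw [← Real.exp_log hρ0, ← Real.exp_add, Real.exp_lt_one_iff, ← lt_neg_iff_add_neg,
    div_lt_iff₀ hc]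
  linarith

lemma one_lt_exp_one_div_mul {ρ : ℝ} (hρ0 : 0 < ρ) (hρ1 : ρ < 1) (h : c < -1 / Real.log ρ) :
    1 < Real.exp (1 / c) * ρ := by
  rw [lt_div_iff_of_neg (Real.log_neg hρ0 hρ1)] at h
  rw [← Real.exp_log hρ0, ← Real.exp_add, Real.one_lt_exp_iff, ← neg_lt_iff_pos_add,
    lt_div_iff₀ hc]
  linarith

lemma tendsto_floor_mul_log : Tendsto (fun n : ℕ => ⌊c * Real.log n⌋₊) atTop atTop :=
  tendsto_nat_floor_atTop.comp <|
    (Real.tendsto_log_atTop.comp tendsto_natCast_atTop_atTop).const_mul_atTop hc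

lemma exp_one_div_pow_floor_le {n : ℕ} (hn : 0 < n) :
    Real.exp (1 / c) ^ ⌊c * Real.log n⌋₊ ≤ n := by
  rw [← Real.exp_nat_mul, ← Real.le_log_iff_exp_le (Nat.cast_pos.2 hn), mul_one_div,
    div_le_iff₀' hc]
  exact Nat.floor_le (mul_nonneg hc.le (Real.log_natCast_nonneg n))

lemma lt_exp_one_div_pow_floor_add_one {n : ℕ} (hn : 0 < n) :
    (n : ℝ) < Real.exp (1 / c) ^ (⌊c * Real.log n⌋₊ + 1) := by
  rw [← Real.exp_nat_mul, ← Real.log_lt_iff_lt_exp (Nat.cast_pos.2 hn), mul_one_div,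
    lt_div_iff₀' hc, Nat.cast_succ]
  exact Nat.lt_floor_add_one _

end LogScale

section BorelCantelli

lemma ae_eventually_notMem_of_real_le {α : Type*} [MeasurableSpace α] {P : Measure α}
    [IsFiniteMeasure P] {s : ℕ → Set α} {f : ℕ → ℝ} (hf : Summable f)
    (h : ∀ k, P.real (s k) ≤ f k) : ∀ᵐ a ∂P, ∀ᶠ k in atTop, a ∉ s k := by
  have hreal : Summable fun k => P.real (s k) :=
    hf.of_nonneg_of_le (fun _ => measureReal_nonneg) h
  refine ae_eventually_notMem ?_
  simpa only [ofReal_measureReal (measure_ne_top _ _)] using hreal.tsum_ofReal_ne_top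

variable {E : Type*} [AddCommGroup E] [Countable E] [MeasurableSpace E] [DiscreteMeasurableSpace E]
  (μ : Measure E) [IsProbabilityMeasure μ]

lemma real_exists_lt_visits_le {A : Finset E} {N k : ℕ} {p : ℝ}
    (hp : ∀ a ∈ A, visitTail μ A N a (k + 1) ≤ p) :
    (seqLaw μ).real {e | ∃ x, k < visits A x e N} ≤ N * (A.card * p) := by
  have hsub : {e : ℕ → E | ∃ x, k < visits A x e N} ⊆
      ⋃ m ∈ Finset.range N, ⋃ a ∈ A, shift m ⁻¹' {e | k + 1 ≤ visits A a e N} := by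
    rintro e ⟨x, hx⟩
    obtain h0 | ⟨m, hm, a, ha, hle⟩ := visits_eq_zero_or_le (A : Set E) x e N
    · omega
    · simp only [Set.mem_iUnion]
      exact ⟨m, Finset.mem_range.2 hm, a, ha, hx.trans_le hle⟩
  have hstart (m : ℕ) :
      (seqLaw μ).real (⋃ a ∈ A, shift m ⁻¹' {e | k + 1 ≤ visits A a e N}) ≤ A.card * p := by
    refine (measureReal_biUnion_finset_le _ _).trans ?_
    rw [← nsmul_eq_mul]
    refine Finset.sum_le_card_nsmul _ _ _ fun a ha => ?_
    rw [real_preimage_shift μ m (measurableSet_le_visits A N a (k + 1))]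
    exact hp a ha
  refine (measureReal_mono hsub (measure_ne_top _ _)).trans <|
    (measureReal_biUnion_finset_le _ _).trans ?_
  simpa using Finset.sum_le_card_nsmul (Finset.range N) _ _ fun m _ => hstart m

/- All times `n` with `⌊c * log n⌋₊ = k` are at most `exp ((k + 1) / c)`, so that one event for each
`k` suffices, and its probability decays geometrically in `k`. -/
lemma ae_eventually_visits_le {A : Finset E} {C ρ c : ℝ} (hρ : 0 ≤ ρ)
    (h : ∀ n, ∀ a ∈ A, ∀ k, visitTail μ A n a (k + 1) ≤ C * ρ ^ k) (hc : 0 < c)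
    (hcρ : Real.exp (1 / c) * ρ < 1) :
    ∀ᵐ e ∂seqLaw μ, ∀ᶠ n : ℕ in atTop, ∀ x, (visits A x e (n + 1) : ℝ) ≤ c * Real.log n := by
  set q := Real.exp (1 / c)
  have hq : 1 ≤ q := Real.one_le_exp (one_div_pos.2 hc).le
  have hbound (k : ℕ) : (seqLaw μ).real {e | ∃ x, k < visits A x e (⌊q ^ (k + 1)⌋₊ + 1)} ≤
      2 * q * (A.card * |C|) * (q * ρ) ^ k := by
    have hN : ((⌊q ^ (k + 1)⌋₊ + 1 : ℕ) : ℝ) ≤ 2 * q ^ (k + 1) := by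
      push_cast
      linarith [Nat.floor_le (zero_le_one.trans (one_le_pow₀ hq (n := k + 1))),
        one_le_pow₀ hq (n := k + 1)]
    calc _ ≤ ((⌊q ^ (k + 1)⌋₊ + 1 : ℕ) : ℝ) * (A.card * (|C| * ρ ^ k)) :=
          real_exists_lt_visits_le μ fun a ha => (h _ a ha k).trans <|
            mul_le_mul_of_nonneg_right (le_abs_self C) (pow_nonneg hρ k)
      _ ≤ 2 * q ^ (k + 1) * (A.card * (|C| * ρ ^ k)) := by gcongr
      _ = 2 * q * (A.card * |C|) * (q * ρ) ^ k := by ring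
  have hsum : Summable fun k : ℕ => 2 * q * (A.card * |C|) * (q * ρ) ^ k :=
    (summable_geometric_of_lt_one (by positivity) hcρ).mul_left _
  filter_upwards [ae_eventually_notMem_of_real_le hsum hbound] with e he
  filter_upwards [(tendsto_floor_mul_log hc).eventually he, eventually_gt_atTop 0]
    with n hn hn0 x
  have hle : visits A x e (n + 1) ≤ ⌊c * Real.log n⌋₊ := by
    refine (visits_mono _ x e (Nat.succ_le_succ ?_)).trans (not_lt.1 fun hlt => hn ⟨x, hlt⟩)
    exact Nat.le_floor (lt_exp_one_div_pow_floor_add_one hc hn0).le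
  exact (Nat.cast_le.2 hle).trans
    (Nat.floor_le (mul_nonneg hc.le (Real.log_natCast_nonneg n)))

lemma real_forall_visits_shift_lt (A : Set E) (H k M : ℕ) :
    (seqLaw μ).real {e | ∀ i < M, visits A 0 (shift (i * H) e) H < k} =
      (1 - visitTail μ A H 0 k) ^ M := by
  have hmeas : MeasurableSet {e : ℕ → E | k ≤ visits A 0 e H} := measurableSet_le_visits A H 0 k
  have hpast : past H ⁻¹' {e : ℕ → E | k ≤ visits A 0 e H}ᶜ = {e | k ≤ visits A 0 e H}ᶜ := by
    simp only [Set.preimage_compl, Set.preimage_ofPred_eq, visits_past]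
  rw [visitTail, ← probReal_compl_eq_one_sub hmeas, ← real_forall_shift_mem μ hmeas.compl hpast]
  simp only [Set.mem_compl_iff, Set.mem_ofPred_eq, not_le]

lemma one_sub_pow_le_inv {p x : ℝ} {M : ℕ} (hp : p ≤ 1) (hx : 0 < x) (hxM : x ≤ p * M) :
    (1 - p) ^ M ≤ x⁻¹ :=
  calc (1 - p) ^ M ≤ Real.exp (-p) ^ M :=
        pow_le_pow_left₀ (sub_nonneg.2 hp) (Real.one_sub_le_exp_neg p) M
    _ = (Real.exp (p * M))⁻¹ := by rw [← Real.exp_nat_mul, ← Real.exp_neg, mul_comm p, mul_neg]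
    _ ≤ x⁻¹ := inv_anti₀ hx (by linarith [Real.add_one_le_exp (p * M)])

lemma eventually_ceil_pow_mul_le {t q : ℝ} (ht : 1 ≤ t) (htq : t < q) (T s : ℕ) :
    ∀ᶠ k : ℕ in atTop, ((⌈t ^ k⌉₊ * (k * T + s) : ℕ) : ℝ) ≤ q ^ k := by
  have hq : 0 < q := by linarith
  have hratio0 : 0 ≤ t / q := by positivity
  have hratio1 : t / q < 1 := (div_lt_one hq).2 htq
  have hlim : Tendsto (fun k : ℕ => 2 * T * (k * (t / q) ^ k) + 2 * s * (t / q) ^ k) atTop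
      (𝓝 0) := by
    simpa using ((tendsto_self_mul_const_pow_of_lt_one hratio0 hratio1).const_mul (2 * (T : ℝ))).add
      ((tendsto_pow_atTop_nhds_zero_of_lt_one hratio0 hratio1).const_mul (2 * (s : ℝ)))
  filter_upwards [hlim.eventually_le_const one_pos] with k hk
  have hceil : (⌈t ^ k⌉₊ : ℝ) ≤ 2 * t ^ k := by
    linarith [Nat.ceil_lt_add_one (zero_le_one.trans (one_le_pow₀ ht (n := k))),
      one_le_pow₀ ht (n := k)]
  calc ((⌈t ^ k⌉₊ * (k * T + s) : ℕ) : ℝ) ≤ 2 * t ^ k * (k * T + s) := by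
        push_cast
        gcongr
    _ = (2 * T * (k * (t / q) ^ k) + 2 * s * (t / q) ^ k) * q ^ k := by
        rw [div_pow]
        field_simp
    _ ≤ q ^ k := mul_le_of_le_one_left (by positivity) hk

lemma ae_eventually_le_visits {A : Set E} {b r c : ℝ} {T s : ℕ} (hb : 0 < b) (hr : 0 < r)
    (h : ∀ k, b * r ^ k ≤ visitTail μ A (k * T + s) 0 (k + 1)) (hc : 0 < c)
    (hcr : 1 < Real.exp (1 / c) * r) :
    ∀ᵐ e ∂seqLaw μ, ∀ᶠ n : ℕ in atTop, ∃ m ≤ n,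
      c * Real.log n ≤ visits A (-walk e m) e (n + 1) := by
  obtain ⟨t, ht, htq⟩ : ∃ t, max 1 r⁻¹ < t ∧ t < Real.exp (1 / c) := exists_between <|
    max_lt (Real.one_lt_exp_iff.2 (one_div_pos.2 hc)) ((inv_lt_iff_one_lt_mul₀ hr).2 hcr)
  obtain ⟨ht1, hrt⟩ := max_lt_iff.1 ht
  have hbound (k : ℕ) : (seqLaw μ).real {e | ∀ i < ⌈t ^ k⌉₊,
      visits A 0 (shift (i * (k * T + s)) e) (k * T + s) < k + 1} ≤ b⁻¹ * (t * r)⁻¹ ^ k := by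
    rw [real_forall_visits_shift_lt, inv_pow, ← mul_inv]
    refine one_sub_pow_le_inv (visitTail_le_one μ A _ 0 _) (by positivity) ?_
    rw [mul_pow, mul_left_comm, mul_comm]
    exact mul_le_mul (h k) (Nat.le_ceil _) (by positivity) (visitTail_nonneg μ A _ 0 _)
  have hsum : Summable fun k : ℕ => b⁻¹ * (t * r)⁻¹ ^ k :=
    (summable_geometric_of_lt_one (by positivity)
      (inv_lt_one_of_one_lt₀ ((inv_lt_iff_one_lt_mul₀ hr).1 hrt))).mul_left _
  filter_upwards [ae_eventually_notMem_of_real_le hsum hbound] with e he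
  filter_upwards [(tendsto_floor_mul_log hc).eventually he,
    (tendsto_floor_mul_log hc).eventually (eventually_ceil_pow_mul_le ht1.le htq T s),
    eventually_gt_atTop 0] with n hn hlen hn0
  set k := ⌊c * Real.log n⌋₊
  set H := k * T + s
  obtain ⟨i, hi, hvisits⟩ : ∃ i < ⌈t ^ k⌉₊, k + 1 ≤ visits A 0 (shift (i * H) e) H := by
    simpa only [Set.mem_ofPred_eq, not_forall, not_lt, exists_prop] using hn
  have hend : i * H + H ≤ n := by
    rw [← Nat.succ_mul]
    exact (Nat.mul_le_mul_right H hi).trans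
      (Nat.cast_le.1 (hlen.trans (exp_one_div_pow_floor_le hc hn0)))
  have hle : k + 1 ≤ visits A (-walk e (i * H)) e (n + 1) :=
    hvisits.trans <| (visits_shift_le A e _ _).trans (visits_mono A _ e (by omega))
  refine ⟨i * H, by omega, (Nat.lt_floor_add_one (c * Real.log n)).le.trans ?_⟩
  exact_mod_cast hle

end BorelCantelli

section AlmostSureLimit

lemma ae_tendsto_iSup {Ω : Type*} [MeasurableSpace Ω] {P : Measure Ω} {κ : ℕ → Type*}
    [∀ n, Nonempty (κ n)] {f : ∀ n, κ n → Ω → ℝ} {b l : ℝ} (hb : b < l)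
    (hupper : ∀ c, l < c → ∀ᵐ ω ∂P, ∀ᶠ n in atTop, ∀ i, f n i ω ≤ c)
    (hlower : ∀ c, b < c → c < l → ∀ᵐ ω ∂P, ∀ᶠ n in atTop, ∃ i, c ≤ f n i ω) :
    ∀ᵐ ω ∂P, Tendsto (fun n => ⨆ i, f n i ω) atTop (𝓝 l) := by
  have hupper' : ∀ᵐ ω ∂P, ∀ q : ℚ, l < q → ∀ᶠ n in atTop, ∀ i, f n i ω ≤ q :=
    ae_all_iff.2 fun q => eventually_imp_distrib_left.2 (hupper q)
  have hlower' : ∀ᵐ ω ∂P, ∀ q : ℚ, b < q → (q : ℝ) < l → ∀ᶠ n in atTop, ∃ i, q ≤ f n i ω :=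
    ae_all_iff.2 fun q => eventually_imp_distrib_left.2 fun hbq =>
      eventually_imp_distrib_left.2 (hlower q hbq)
  filter_upwards [hupper', hlower'] with ω hup hlow
  refine tendsto_order.2 ⟨fun a ha => ?_, fun a ha => ?_⟩
  · obtain ⟨q, hq, hql⟩ := exists_rat_btwn (max_lt ha hb)
    obtain ⟨haq, hbq⟩ := max_lt_iff.1 hq
    obtain ⟨q', hq', -⟩ := exists_rat_btwn (lt_add_one l)
    filter_upwards [hlow q hbq hql, hup q' hq'] with n ⟨i, hi⟩ hbdd
    exact haq.trans_le (hi.trans (le_ciSup ⟨_, Set.forall_mem_range.2 hbdd⟩ i))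
  · obtain ⟨q, hlq, hqa⟩ := exists_rat_btwn ha
    filter_upwards [hup q hlq] with n hn
    exact (ciSup_le hn).trans_lt hqa

lemma one_sub_one_div_mem_Ioo {L : ℝ} (hL : 1 < L) : 1 - 1 / L ∈ Set.Ioo 0 1 :=
  ⟨sub_pos.2 ((div_lt_one (one_pos.trans hL)).2 hL),
    sub_lt_self 1 (one_div_pos.2 (one_pos.trans hL))⟩

variable {E : Type*} [AddCommGroup E] [Countable E] [MeasurableSpace E] [DiscreteMeasurableSpace E]
  {μ : Measure E} [IsProbabilityMeasure μ]

lemma ae_eventually_visits_div_log_le {A : Finset E} {v : E → ℝ} (hv : ∀ x ∈ A, 0 < v x) {L : ℝ}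
    (hL : 1 < L) (hlim : ∀ x ∈ A, Tendsto (fun n => potential μ A v n x) atTop (𝓝 (L * v x)))
    {c : ℝ} (hc0 : 0 < c) (hc : -1 / Real.log (1 - 1 / L) < c) :
    ∀ᵐ e ∂seqLaw μ, ∀ᶠ n : ℕ in atTop, ∀ x, visits A x e (n + 1) / Real.log n ≤ c := by
  obtain ⟨hρ0, hρ1⟩ := one_sub_one_div_mem_Ioo hL
  obtain ⟨C, hC⟩ := exists_visitTail_le hv hL hlim
  filter_upwards [ae_eventually_visits_le μ hρ0.le hC hc0
    (exp_one_div_mul_lt_one hc0 hρ0 hρ1 hc)] with e he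
  filter_upwards [he, eventually_ge_atTop 2] with n hn hn2 x
  exact (div_le_iff₀ (Real.log_pos (Nat.one_lt_cast.2 hn2))).2 (hn x)

lemma ae_eventually_exists_le_visits_div_log [μ.IsNegInvariant]
    (hgen : AddSubgroup.closure {z | 0 < μ.real {z}} = ⊤) {A : Finset E} (hA : A.Nonempty)
    {v : E → ℝ} (hv : ∀ x ∈ A, 0 < v x) {L : ℝ} (hL : 1 < L)
    (hlim : ∀ x ∈ A, Tendsto (fun n => potential μ A v n x) atTop (𝓝 (L * v x)))
    {c : ℝ} (hc0 : 0 < c) (hc : c < -1 / Real.log (1 - 1 / L)) :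
    ∀ᵐ e ∂seqLaw μ, ∀ᶠ n : ℕ in atTop, ∃ m : Fin (n + 1),
      c ≤ visits A (-walk e m) e (n + 1) / Real.log n := by
  obtain ⟨hρ0, hρ1⟩ := one_sub_one_div_mem_Ioo hL
  have hexp := Real.exp_pos (1 / c)
  obtain ⟨r, hcr, hr⟩ := exists_between <| (inv_lt_iff_one_lt_mul₀' hexp).2
    (one_lt_exp_one_div_mul hc0 hρ0 hρ1 hc)
  have hr0 : 0 < r := (inv_pos.2 hexp).trans hcr
  obtain ⟨b, hb, T, s, hTs⟩ := exists_le_visitTail hgen hA hv hL hlim hr0 hr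
  filter_upwards [ae_eventually_le_visits μ hb hr0 hTs hc0
    ((inv_lt_iff_one_lt_mul₀' hexp).1 hcr)] with e he
  filter_upwards [he, eventually_ge_atTop 2] with n ⟨m, hmn, hm⟩ hn2
  exact ⟨⟨m, Nat.lt_succ_of_le hmn⟩, (le_div_iff₀ (Real.log_pos (Nat.one_lt_cast.2 hn2))).2 hm⟩

theorem ae_tendsto_iSup_visits [DecidableEq E] [μ.IsNegInvariant]
    (hgen : AddSubgroup.closure {z | 0 < μ.real {z}} = ⊤)
    (htrans : ∀ᵐ e ∂seqLaw μ, {n | walk e n = 0}.Finite) {A : Finset E} (hA : A.Nonempty) :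
    (∀ᵐ e ∂seqLaw μ, Tendsto (fun n : ℕ => ⨆ x, visits A (-x) e (n + 1) / Real.log n) atTop
      (𝓝 (-1 / Real.log (1 - 1 / largestEigenvalue (potentialMatrix μ A))))) ∧
    ∀ᵐ e ∂seqLaw μ, Tendsto
      (fun n : ℕ => ⨆ m : Fin (n + 1), visits A (-walk e m) e (n + 1) / Real.log n) atTop
      (𝓝 (-1 / Real.log (1 - 1 / largestEigenvalue (potentialMatrix μ A)))) := by
  obtain ⟨v, hv, hlim⟩ :=
    exists_pos_tendsto_potential hgen (summable_transitionProb hgen htrans) hA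
  have hL := one_lt_of_tendsto_potential hA hv hlim
  obtain ⟨hρ0, hρ1⟩ := one_sub_one_div_mem_Ioo hL
  have hl := div_pos_of_neg_of_neg neg_one_lt_zero (Real.log_neg hρ0 hρ1)
  have hupper {c : ℝ} (hc) :=
    ae_eventually_visits_div_log_le (c := c) hv hL hlim (hl.trans hc) hc
  have hlower (c : ℝ) := ae_eventually_exists_le_visits_div_log (c := c) hgen hA hv hL hlim
  refine ⟨ae_tendsto_iSup hl (fun c hc => ?_) fun c hc0 hc => ?_,
    ae_tendsto_iSup hl (fun c hc => ?_) hlower⟩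
  · filter_upwards [hupper hc] with e he
    exact he.mono fun n hn x => hn (-x)
  · filter_upwards [hlower c hc0 hc] with e he
    exact he.mono fun n ⟨m, hm⟩ => ⟨walk e m, hm⟩
  · filter_upwards [hupper hc] with e he
    exact he.mono fun n hn m => hn (-walk e m)

end AlmostSureLimit

section Increments

variable {Ω : Type*} [MeasurableSpace Ω] {P : Measure Ω} {E : Type*} [AddCommGroup E]
  {X : ℕ → Ω → E}

/-- The increments `X (n + 1) - X n` of a process `X`, as one random sequence. -/
def increments (X : ℕ → Ω → E) (ω : Ω) : ℕ → E := fun n => X (n + 1) ω - X n ω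

lemma ae_eq_walk_increments (hstart : ∀ᵐ ω ∂P, X 0 ω = 0) :
    ∀ᵐ ω ∂P, ∀ n, X n ω = walk (increments X ω) n := by
  filter_upwards [hstart] with ω h0 n
  exact ((walk_sub_apply (fun n => X n ω) n).trans (by rw [h0, sub_zero])).symm

lemma sum_indicator_vadd_eq_visits (A : Set E) (x : E) (e : ℕ → E) (n : ℕ) :
    ∑ j ∈ Finset.range n, (x +ᵥ A).indicator (fun _ => (1 : ℝ)) (walk e j) =
      visits A (-x) e n := by
  classical
  simp only [visits, Set.indicator_apply, Set.mem_vadd_set_iff_neg_vadd_mem, vadd_eq_add,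
    Pi.one_apply, Nat.cast_sum, Nat.cast_ite, Nat.cast_one, Nat.cast_zero]

variable [MeasurableSpace E]

/-- The law of the first increment. -/
def stepLaw (P : Measure Ω) (X : ℕ → Ω → E) : Measure E := P.map fun ω => X 1 ω - X 0 ω

variable [DiscreteMeasurableSpace E]

lemma isNegInvariant_stepLaw (hX : Measurable (X 1)) (hstart : ∀ᵐ ω ∂P, X 0 ω = 0)
    (hsymm : IdentDistrib (X 1) (fun ω => -X 1 ω) P P) : (stepLaw P X).IsNegInvariant := by
  have hstep : stepLaw P X = P.map (X 1) := by
    refine Measure.map_congr ?_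
    filter_upwards [hstart] with ω h0
    rw [h0, sub_zero]
  refine ⟨?_⟩
  rw [hstep, Measure.neg, Measure.map_map Measurable.of_discrete hX]
  exact hsymm.map_eq.symm

variable [Countable E]

lemma measurable_increment (hX : ∀ n, Measurable (X n)) (n : ℕ) :
    Measurable fun ω => X (n + 1) ω - X n ω := by
  have : MeasurableSub₂ E := ⟨Measurable.of_discrete⟩
  exact (hX (n + 1)).sub (hX n)

lemma measurable_increments (hX : ∀ n, Measurable (X n)) : Measurable (increments X) :=
  measurable_pi_lambda _ (measurable_increment hX)

lemma map_increments (hX : ∀ n, Measurable (X n))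
    (hindep : iIndepFun (fun n ω => X (n + 1) ω - X n ω) P)
    (hident : ∀ n,
      IdentDistrib (fun ω => X (n + 1) ω - X n ω) (fun ω => X 1 ω - X 0 ω) P P) :
    P.map (increments X) = seqLaw (stepLaw P X) := by
  have hmap := hindep.map_fun_eq_infinitePi_map (measurable_increment hX)
  simp only [fun n => (hident n).map_eq] at hmap
  exact hmap

lemma transitionProb_eq_real_of_ae_eq_walk {μ : Measure E} (hX : ∀ n, Measurable (X n))
    (hlaw : P.map (increments X) = seqLaw μ)
    (hwalk : ∀ᵐ ω ∂P, ∀ n, X n ω = walk (increments X ω) n) (k : ℕ) (x : E) :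
    transitionProb μ k x = P.real {ω | X k ω = x} := by
  rw [transitionProb, ← hlaw,
    map_measureReal_apply (measurable_increments hX) (measurableSet_walk_eq k x)]
  refine measureReal_congr ?_
  filter_upwards [hwalk] with ω hω
  exact congrArg (· = x) (hω k).symm

lemma ae_finite_walk_eq_zero_of_ae_eq_walk {μ : Measure E} (hX : ∀ n, Measurable (X n))
    (hlaw : P.map (increments X) = seqLaw μ)
    (hwalk : ∀ᵐ ω ∂P, ∀ n, X n ω = walk (increments X ω) n)
    (htrans : ∀ᵐ ω ∂P, {n | X n ω = 0}.Finite) :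
    ∀ᵐ e ∂seqLaw μ, {n | walk e n = 0}.Finite := by
  rw [← hlaw, ae_map_iff (measurable_increments hX).aemeasurable measurableSet_finite_walk_eq_zero]
  filter_upwards [htrans, hwalk] with ω hfin hω
  simpa only [hω] using hfin

variable [IsProbabilityMeasure P]

lemma isProbabilityMeasure_stepLaw (hX : ∀ n, Measurable (X n)) :
    IsProbabilityMeasure (stepLaw P X) :=
  Measure.isProbabilityMeasure_map (measurable_increment hX 0).aemeasurable

lemma ae_real_stepLaw_increment_pos (hX : ∀ n, Measurable (X n))
    (hident : ∀ n,
      IdentDistrib (fun ω => X (n + 1) ω - X n ω) (fun ω => X 1 ω - X 0 ω) P P) :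
    ∀ᵐ ω ∂P, ∀ n, 0 < (stepLaw P X).real {X (n + 1) ω - X n ω} := by
  have := isProbabilityMeasure_stepLaw (P := P) hX
  refine ae_all_iff.2 fun n => ?_
  have hlaw : stepLaw P X = P.map fun ω => X (n + 1) ω - X n ω := (hident n).map_eq.symm
  have hpos := ae_real_singleton_pos (stepLaw P X)
  nth_rw 2 [hlaw] at hpos
  exact ae_of_ae_map (measurable_increment hX n).aemeasurable hpos

lemma closure_stepLaw_support_eq_top (hX : ∀ n, Measurable (X n))
    (hstart : ∀ᵐ ω ∂P, X 0 ω = 0)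
    (hident : ∀ n,
      IdentDistrib (fun ω => X (n + 1) ω - X n ω) (fun ω => X 1 ω - X 0 ω) P P)
    (hfull : ∀ H : AddSubgroup E, (∀ᵐ ω ∂P, ∀ n, X n ω ∈ H) → H = ⊤) :
    AddSubgroup.closure {z | 0 < (stepLaw P X).real {z}} = ⊤ := by
  refine hfull _ ?_
  filter_upwards [ae_eq_walk_increments hstart, ae_real_stepLaw_increment_pos hX hident]
    with ω hwalk hpos n
  rw [hwalk]
  exact AddSubgroup.sum_mem _ fun i _ => AddSubgroup.subset_closure (hpos i)

end Increments

end

end LatticeWalk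

open LatticeWalk in
theorem theorem1p1_general {E : Type*} [AddCommGroup E] [Countable E] [DecidableEq E]
    [MeasurableSpace E] [DiscreteMeasurableSpace E] {Ω : Type*} [MeasurableSpace Ω]
    (P : Measure Ω) [IsProbabilityMeasure P] (X : ℕ → Ω → E)
    (hX : ∀ n, Measurable (X n)) (hstart : ∀ᵐ ω ∂P, X 0 ω = 0)
    (hindep : iIndepFun (fun n ω => X (n + 1) ω - X n ω) P)
    (hident : ∀ n,
      IdentDistrib (fun ω => X (n + 1) ω - X n ω) (fun ω => X 1 ω - X 0 ω) P P)
    (hsymm : IdentDistrib (X 1) (fun ω => -X 1 ω) P P)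
    (htrans : ∀ᵐ ω ∂P, {n : ℕ | X n ω = 0}.Finite)
    (hfull : ∀ H : AddSubgroup E, (∀ᵐ ω ∂P, ∀ n, X n ω ∈ H) → H = ⊤)
    (A : Finset E) (hA : A.Nonempty) :
    let G : Matrix A A ℝ := Matrix.of fun x y => ∑' k, P.real {ω | X k ω = x.1 - y.1}
    let N (n : ℕ) (x : E) (ω : Ω) : ℝ :=
      ∑ j ∈ Finset.range (n + 1), (x +ᵥ (A : Set E)).indicator (fun _ => (1 : ℝ)) (X j ω)
    (∀ᵐ ω ∂P, Tendsto (fun n : ℕ => ⨆ x, N n x ω / Real.log n) atTop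
      (𝓝 (-1 / Real.log (1 - 1 / largestEigenvalue G)))) ∧
    ∀ᵐ ω ∂P, Tendsto (fun n : ℕ => ⨆ m : Fin (n + 1), N n (X m ω) ω / Real.log n) atTop
      (𝓝 (-1 / Real.log (1 - 1 / largestEigenvalue G))) := by
  intro G N
  have := isProbabilityMeasure_stepLaw (P := P) hX
  have := isNegInvariant_stepLaw (hX 1) hstart hsymm
  have hmeas := (measurable_increments hX).aemeasurable (μ := P)
  have hlaw := map_increments hX hindep hident
  have hwalk := ae_eq_walk_increments hstart
  have hgreen : potentialMatrix (stepLaw P X) A = G := by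
    ext x y
    exact tsum_congr fun k => transitionProb_eq_real_of_ae_eq_walk hX hlaw hwalk k _
  have hcount {ω} (hω : ∀ n, X n ω = walk (increments X ω) n) (n : ℕ) (x : E) :
      N n x ω = visits A (-x) (increments X ω) (n + 1) := by
    simp only [N, hω, sum_indicator_vadd_eq_visits]
  obtain ⟨hspace, hrange⟩ := ae_tendsto_iSup_visits
    (closure_stepLaw_support_eq_top hX hstart hident hfull)
    (ae_finite_walk_eq_zero_of_ae_eq_walk hX hlaw hwalk htrans) hA
  rw [← hlaw, hgreen] at hspace hrange
  constructor
  · filter_upwards [hwalk, ae_of_ae_map hmeas hspace] with ω hω hlim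
    simpa only [hcount hω] using hlim
  · filter_upwards [hwalk, ae_of_ae_map hmeas hrange] with ω hω hlim
    simpa only [hcount hω, hω] using hlim

theorem theorem1p1 {d : ℕ} (hd : 3 ≤ d) {Ω : Type*} [MeasurableSpace Ω]
    (P : Measure Ω) [IsProbabilityMeasure P] (X : ℕ → Ω → (Fin d → ℤ))
    (hX : LatticeWalk.IsRandomWalk P X)
    (hsymm : LatticeWalk.IsSymmetricWalk P X)
    (htrans : LatticeWalk.IsTransient P X)
    (hfull : LatticeWalk.NotSupportedOnProperSubgroup P X)
    (hmom : LatticeWalk.HasFiniteSecondMoments P X)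
    (A : Finset (Fin d → ℤ)) (hA : A.Nonempty) :
    (∀ᵐ ω ∂P, Tendsto
      (fun n : ℕ => ⨆ x : Fin d → ℤ,
        LatticeWalk.occupation X n (x +ᵥ (A : Set (Fin d → ℤ))) ω / Real.log n)
      atTop
      (𝓝 (-1 / Real.log
        (1 - 1 / LatticeWalk.largestEigenvalue (LatticeWalk.greenMatrix P X A))))) ∧
    (∀ᵐ ω ∂P, Tendsto
      (fun n : ℕ => ⨆ m : Fin (n + 1),
        LatticeWalk.occupation X n (X m ω +ᵥ (A : Set (Fin d → ℤ))) ω / Real.log n)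
      atTop
      (𝓝 (-1 / Real.log
        (1 - 1 / LatticeWalk.largestEigenvalue (LatticeWalk.greenMatrix P X A))))) :=
  theorem1p1_general P X hX.measurable hX.start hX.indep hX.identDistrib hsymm htrans hfull A hA
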